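/- For a complex number $\alpha$ and a finite set $F\subset\mathbb{Z}$, let $$F[\alpha]=\Big\{\sum_{j=0}^{n}\varepsilon_j\alpha^j \;:\; n\in\mathbb{Z}_{\ge 0},\ \varepsilon_0,\dots,\varepsilon_n\in F\Big\}.$$ Theorem. Let $\alpha\in\mathbb{C}$. There is a finite set $F\subset\mathbb{Z}$ with $F[\alpha]=\mathbb{Z}[\alpha]$ (the height reducing property) if and only if $\alpha$ is an algebraic number whose conjugates over $\mathbb{Q}$ (that is, the complex roots of its minimal polynomial over $\mathbb{Q}$, including $\alpha$ itself) all have modulus one, or all have modulus greater than one. -/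

import Mathlib

/-- The set `F[α]` of all sums `∑_{j=0}^n ε_j α^j` with `n ≥ 0` and `ε_0, …, ε_n ∈ F`. -/
def digitSums (F : Finset ℤ) (α : ℂ) : Set ℂ :=
  {z | ∃ (n : ℕ) (ε : Fin (n + 1) → ℤ), (∀ j, ε j ∈ F) ∧ z = ∑ j, (ε j : ℂ) * α ^ (j : ℕ)}

/-- The height reducing property: `F[α] = ℤ[α]` for some finite `F ⊆ ℤ`. -/
def HeightReducing (α : ℂ) : Prop :=
  ∃ F : Finset ℤ, digitSums F α = (Algebra.adjoin ℤ {α} : Set ℂ)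

open Polynomial

/-! ### Conjugates of a height reducing number -/

section Necessity

/-! Necessity: a digit expansion of an integer in `α` holds at every conjugate, so a conjugate
inside the unit disc would bound all integers; one on the unit circle makes the conjugates closed
under inversion, forcing all onto it.

Sufficiency: divide repeatedly, `P = s + q m + X Q`, with `m` an integer multiple of the minimal
polynomial. On the vector of values at the conjugates `r i` this is `v ↦ (v - s) / r`. If all `‖r i‖
> 1` it contracts large vectors. If all `‖r i‖ = 1`, the sign of `s` is chosen against the inner
product of `v` with `(1, …, 1)`; over `d` steps these products approximate those of `v` with all `r
^ j`, which span by Vandermonde, so a large `v` must shrink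
(`exists_sumSq_iterate_le_sub_one_of_norm_eq_one`). -/

theorem aeval_eq_zero_of_isConjRoot {α β : ℂ} (h : IsConjRoot ℚ α β) {P : ℤ[X]}
    (hP : aeval α P = 0) : aeval β P = 0 := by
  have h1 : aeval α (P.map (algebraMap ℤ ℚ)) = 0 := by rwa [aeval_map_algebraMap]
  obtain ⟨Q, hQ⟩ := minpoly.dvd ℚ α h1
  rw [← aeval_map_algebraMap ℚ, hQ, map_mul, h.aeval_eq_zero, zero_mul]

theorem aeval_sum_C_mul_X_pow (α : ℂ) {n : ℕ} (ε : Fin n → ℤ) :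
    aeval α (∑ j, C (ε j) * X ^ (j : ℕ) : ℤ[X]) = ∑ j, (ε j : ℂ) * α ^ (j : ℕ) := by
  simp [map_sum]

theorem coeff_zero_sum_C_mul_X_pow {n : ℕ} (ε : Fin (n + 1) → ℤ) :
    (∑ j, C (ε j) * X ^ (j : ℕ) : ℤ[X]).coeff 0 = ε 0 := by
  simp [Fin.sum_univ_succ, coeff_X_pow]

theorem HeightReducing.isAlgebraic {α : ℂ} (h : HeightReducing α) : IsAlgebraic ℚ α := by
  obtain ⟨F, hF⟩ := h
  -- `N ∉ F` keeps the constant term `ε 0 - N` of the relation nonzero.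
  obtain ⟨N, hN⟩ := F.exists_notMem
  have hmem : (N : ℂ) ∈ digitSums F α := by
    rw [hF]; exact intCast_mem _ N
  obtain ⟨n, ε, hε, hz⟩ := hmem
  have hI : IsAlgebraic ℤ α := by
    refine ⟨(∑ j, C (ε j) * X ^ (j : ℕ)) - C N, ?_, ?_⟩
    · intro h0
      have := congrArg (fun P : ℤ[X] => P.coeff 0) h0
      simp only [coeff_sub, coeff_zero_sum_C_mul_X_pow, coeff_C_zero, coeff_zero] at this
      exact hN (by rw [← sub_eq_zero.1 this]; exact hε 0)
    · rw [map_sub, aeval_sum_C_mul_X_pow, ← hz]; simp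
  exact (IsFractionRing.isAlgebraic_iff ℤ ℚ ℂ).1 hI

theorem HeightReducing.one_le_norm {α : ℂ} (h : HeightReducing α) {β : ℂ}
    (hβ : IsConjRoot ℚ α β) : 1 ≤ ‖β‖ := by
  obtain ⟨F, hF⟩ := h
  by_contra! hlt
  obtain ⟨B, hB⟩ : ∃ B : ℝ, ∀ x ∈ F, ‖(x : ℂ)‖ ≤ B := by
    obtain ⟨B, hB⟩ := (F.image fun x : ℤ => ‖(x : ℂ)‖).bddAbove
    exact ⟨B, fun x hx => hB (by simpa using ⟨x, hx, rfl⟩)⟩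
  have key : ∀ N : ℕ, (N : ℝ) ≤ B * (1 - ‖β‖)⁻¹ := by
    intro N
    have hmem : (N : ℂ) ∈ digitSums F α := by
      rw [hF]; exact natCast_mem _ N
    obtain ⟨n, ε, hε, hz⟩ := hmem
    have hB0 : 0 ≤ B := (norm_nonneg _).trans (hB _ (hε 0))
    have h1 : aeval α ((∑ j, C (ε j) * X ^ (j : ℕ)) - C (N : ℤ)) = 0 := by
      rw [map_sub, aeval_sum_C_mul_X_pow, ← hz]; simp
    have h2 := aeval_eq_zero_of_isConjRoot hβ h1
    rw [map_sub, aeval_sum_C_mul_X_pow, sub_eq_zero] at h2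
    have h3 : (N : ℝ) = ‖∑ j, (ε j : ℂ) * β ^ (j : ℕ)‖ := by rw [h2]; simp
    rw [h3]
    calc _ ≤ ∑ j, ‖(ε j : ℂ) * β ^ (j : ℕ)‖ := norm_sum_le _ _
      _ ≤ ∑ j : Fin (n + 1), B * ‖β‖ ^ (j : ℕ) := by
        refine Finset.sum_le_sum fun j _ => ?_
        rw [norm_mul, norm_pow]
        exact mul_le_mul_of_nonneg_right (hB _ (hε j)) (by positivity)
      _ = B * ∑ j ∈ Finset.range (n + 1), ‖β‖ ^ j := by
        rw [← Finset.mul_sum, Fin.sum_univ_eq_sum_range]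
      _ ≤ B * (1 - ‖β‖)⁻¹ := by
        refine mul_le_mul_of_nonneg_left ?_ hB0
        rw [← tsum_geometric_of_lt_one (norm_nonneg _) hlt]
        exact (summable_geometric_of_lt_one (norm_nonneg _) hlt).sum_le_tsum _
          fun _ _ => by positivity
  obtain ⟨N, hN⟩ := exists_nat_gt (B * (1 - ‖β‖)⁻¹)
  exact absurd (key N) (not_le.2 hN)

/-- A conjugate of modulus one makes the set of conjugates stable under inversion. -/
theorem isConjRoot_inv_of_norm_eq_one {α β γ : ℂ} (hα : IsAlgebraic ℚ α)
    (hβ : IsConjRoot ℚ α β) (h1 : ‖β‖ = 1) (hγ : IsConjRoot ℚ α γ) (hγ0 : γ ≠ 0) :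
    IsConjRoot ℚ α γ⁻¹ := by
  have hint := hα.isIntegral
  rw [isConjRoot_iff_aeval_eq_zero hint]
  have hβ0 : β ≠ 0 := norm_ne_zero_iff.1 (by rw [h1]; exact one_ne_zero)
  have hconj : β⁻¹ = (starRingEnd ℂ) β := Complex.inv_eq_conj h1
  have e1 : aeval β⁻¹ (minpoly ℚ α) = 0 := by
    rw [hconj]
    have := congrArg (starRingEnd ℂ) hβ.aeval_eq_zero
    rw [map_zero] at this
    rw [← this]
    exact (aeval_algHom_apply (Complex.conjAe.toAlgHom.restrictScalars ℚ) β _)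
  -- The minimal polynomial shares the root `β` with its reverse, hence divides it.
  have e2 : aeval β (minpoly ℚ α).reverse = 0 := by
    let := invertibleOfNonzero (inv_ne_zero hβ0)
    have := (eval₂_reverse_eq_zero_iff (algebraMap ℚ ℂ) β⁻¹ (minpoly ℚ α)).2 e1
    rwa [invOf_eq_inv, inv_inv] at this
  have e3 : aeval γ (minpoly ℚ α).reverse = 0 := by
    rw [show minpoly ℚ α = minpoly ℚ β from hβ] at e2 ⊢
    obtain ⟨Q, hQ⟩ := minpoly.dvd ℚ β e2
    rw [hQ, map_mul, (hβ.symm.trans hγ).aeval_eq_zero, zero_mul]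
  let := invertibleOfNonzero hγ0
  let := invertibleOfNonzero (inv_ne_zero hγ0)
  refine (eval₂_reverse_eq_zero_iff (algebraMap ℚ ℂ) γ⁻¹ (minpoly ℚ α)).1 ?_
  rwa [invOf_eq_inv, inv_inv]

theorem HeightReducing.norm_dichotomy {α : ℂ} (h : HeightReducing α) :
    (∀ β : ℂ, IsConjRoot ℚ α β → ‖β‖ = 1) ∨ (∀ β : ℂ, IsConjRoot ℚ α β → 1 < ‖β‖) := by
  by_cases hex : ∃ β, IsConjRoot ℚ α β ∧ ‖β‖ = 1
  · obtain ⟨β, hβ, h1⟩ := hex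
    refine Or.inl fun γ hγ => le_antisymm ?_ (h.one_le_norm hγ)
    have hγ0 : 0 < ‖γ‖ := zero_lt_one.trans_le (h.one_le_norm hγ)
    have := h.one_le_norm
      (isConjRoot_inv_of_norm_eq_one h.isAlgebraic hβ h1 hγ (norm_pos_iff.1 hγ0))
    rw [norm_inv] at this
    exact (one_le_inv₀ hγ0).1 this
  · push Not at hex
    exact Or.inr fun β hβ => lt_of_le_of_ne (h.one_le_norm hβ) (hex β hβ).symm

end Necessity

/-! ### From a decreasing potential to digit expansions -/

section DigitSums

theorem digitSums_subset_adjoin (F : Finset ℤ) (α : ℂ) :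
    digitSums F α ⊆ (Algebra.adjoin ℤ {α} : Set ℂ) := by
  rintro z ⟨n, ε, -, rfl⟩
  exact sum_mem fun j _ => mul_mem (intCast_mem _ _)
    (pow_mem (Algebra.subset_adjoin (Set.mem_singleton α)) _)

theorem intCast_add_mul_mem_digitSums {F : Finset ℤ} {α z : ℂ} {s : ℤ} (hs : s ∈ F)
    (hz : z ∈ digitSums F α) : (s : ℂ) + α * z ∈ digitSums F α := by
  obtain ⟨n, ε, hε, rfl⟩ := hz
  refine ⟨n + 1, Fin.cons s ε, fun j => ?_, ?_⟩
  · refine Fin.cases ?_ (fun i => ?_) j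
    · simpa using hs
    · simpa using hε i
  · rw [Fin.sum_univ_succ (n := n + 1), Finset.mul_sum]
    simp only [Fin.cons_zero, Fin.cons_succ, Fin.val_zero, pow_zero, mul_one, Fin.val_succ,
      pow_succ]
    congr 1
    exact Finset.sum_congr rfl fun i _ => by ring

theorem aeval_mem_digitSums {F : Finset ℤ} (α : ℂ) {P : ℤ[X]} (hP : ∀ j, P.coeff j ∈ F) :
    aeval α P ∈ digitSums F α := by
  refine ⟨P.natDegree, fun j => P.coeff j, fun j => hP j, ?_⟩
  rw [aeval_eq_sum_range, Fin.sum_univ_eq_sum_range (fun j => (P.coeff j : ℂ) * α ^ j)]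
  simp

/-- If a division step `T` with bounded digits lowers degrees to below `d`, and then decreases a
potential with finite sublevel sets, `α` is height reducing. -/
theorem heightReducing_of_potential {α : ℂ} {d : ℕ} (a : ℤ) (σ : ℤ[X] → ℤ) (T : ℤ[X] → ℤ[X])
    (hσ : ∀ P, |σ P| ≤ a) (hT : ∀ P, aeval α P = σ P + α * aeval α (T P))
    (hdeg : ∀ P n, d ≤ n → P.natDegree ≤ n → (T P).natDegree ≤ n - 1)
    (Φ : ℤ[X] → ℝ) (R B : ℝ)
    (hfin : ∀ P : ℤ[X], P.natDegree ≤ d - 1 → Φ P ≤ R → ∀ j, |(P.coeff j : ℝ)| ≤ B)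
    (hdec : ∀ P : ℤ[X], P.natDegree ≤ d - 1 → R < Φ P → ∃ k, Φ (T^[k] P) ≤ Φ P - 1) :
    HeightReducing α := by
  -- One interval holds both the division digits and the coefficients of the terminal polynomials.
  let F : Finset ℤ := Finset.Icc (-(a + ⌈|B|⌉)) (a + ⌈|B|⌉)
  have ha : 0 ≤ a := (abs_nonneg _).trans (hσ 0)
  have hB0 : (0 : ℤ) ≤ ⌈|B|⌉ := Int.ceil_nonneg (abs_nonneg B)
  have hσF : ∀ P, σ P ∈ F := fun P => by
    have := abs_le.1 (hσ P)
    simp only [F, Finset.mem_Icc]; constructor <;> linarith [this.1, this.2]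
  have back : ∀ k P, aeval α (T^[k] P) ∈ digitSums F α → aeval α P ∈ digitSums F α := by
    intro k
    induction k with
    | zero => exact fun P h => h
    | succ k ih =>
      intro P h
      rw [hT P]
      exact intCast_add_mul_mem_digitSums (hσF P) (ih _ h)
  have degT : ∀ k P, P.natDegree ≤ d - 1 → (T^[k] P).natDegree ≤ d - 1 := by
    intro k
    induction k with
    | zero => exact fun P h => h
    | succ k ih => exact fun P h => ih _ (hdeg P d le_rfl (h.trans (Nat.sub_le _ _)))
  have small : ∀ n : ℕ, ∀ P : ℤ[X], P.natDegree ≤ d - 1 → Φ P ≤ R + n →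
      aeval α P ∈ digitSums F α := by
    intro n
    induction n with
    | zero =>
      intro P hP h
      refine aeval_mem_digitSums α fun j => ?_
      have h1 := (hfin P hP (by simpa using h) j).trans ((le_abs_self B).trans (Int.le_ceil _))
      have h2 : |P.coeff j| ≤ ⌈|B|⌉ := by exact_mod_cast h1
      have := abs_le.1 h2
      simp only [F, Finset.mem_Icc]; constructor <;> linarith [this.1, this.2]
    | succ n ih =>
      intro P hP h
      rcases le_or_gt (Φ P) R with hR | hR
      · exact ih P hP (hR.trans (by simp))
      · obtain ⟨k, hk⟩ := hdec P hP hR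
        refine back k P (ih _ (degT k P hP) ?_)
        push_cast at h; linarith
  have lowdeg : ∀ P : ℤ[X], P.natDegree ≤ d - 1 → aeval α P ∈ digitSums F α := by
    intro P hP
    obtain ⟨n, hn⟩ := exists_nat_ge (Φ P - R)
    exact small n P hP (by linarith)
  have all : ∀ n : ℕ, ∀ P : ℤ[X], P.natDegree ≤ d - 1 + n → aeval α P ∈ digitSums F α := by
    intro n
    induction n with
    | zero => exact fun P hP => lowdeg P hP
    | succ n ih =>
      intro P hP
      have := hdeg P (d - 1 + (n + 1)) (by omega) hP
      exact back 1 P (ih _ (by simpa using this))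
  refine ⟨F, (digitSums_subset_adjoin F α).antisymm fun z hz => ?_⟩
  rw [SetLike.mem_coe, Algebra.adjoin_singleton_eq_range_aeval] at hz
  obtain ⟨P, rfl⟩ := hz
  exact all P.natDegree P (Nat.le_add_left _ _)

end DigitSums

/-! ### Division with signed digits -/

section Division

/-- Residues are taken in `1, …, |a|`, not from `0`: a nonzero digit with the sign of `t` gives `|t|
≤ s * t`. -/
theorem exists_digit {a : ℤ} (ha : a ≠ 0) (b : ℤ) (t : ℝ) :
    ∃ s : ℤ, a ∣ b - s ∧ |s| ≤ |a| ∧ |t| ≤ s * t := by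
  rcases le_or_gt 0 t with ht | ht
  · refine ⟨(b - 1) % a + 1, ?_, ?_, ?_⟩
    · have := Int.dvd_self_sub_emod (x := b - 1) (m := a)
      rwa [show b - ((b - 1) % a + 1) = b - 1 - (b - 1) % a by ring]
    · have h1 := Int.emod_nonneg (b - 1) ha
      have h2 := Int.emod_lt_abs (b - 1) ha
      rw [abs_of_nonneg (by linarith)]; linarith
    · have h1 : (0 : ℝ) ≤ ((b - 1) % a : ℤ) := by exact_mod_cast Int.emod_nonneg (b - 1) ha
      rw [abs_of_nonneg ht]; push_cast at h1 ⊢; nlinarith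
  · refine ⟨-((-b - 1) % a + 1), ?_, ?_, ?_⟩
    · have := (dvd_neg (α := ℤ)).2 (Int.dvd_self_sub_emod (x := -b - 1) (m := a))
      rwa [show b - -((-b - 1) % a + 1) = -(-b - 1 - (-b - 1) % a) by ring]
    · have h1 := Int.emod_nonneg (-b - 1) ha
      have h2 := Int.emod_lt_abs (-b - 1) ha
      rw [abs_neg, abs_of_nonneg (by linarith)]; linarith
    · have h1 : (0 : ℝ) ≤ ((-b - 1) % a : ℤ) := by exact_mod_cast Int.emod_nonneg (-b - 1) ha
      rw [abs_of_neg ht]; push_cast at h1 ⊢; nlinarith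

theorem exists_eq_C_add_C_mul_add_X_mul (m P : ℤ[X]) {s : ℤ} (hs : m.coeff 0 ∣ P.coeff 0 - s) :
    ∃ (q : ℤ) (Q : ℤ[X]), P = C s + C q * m + X * Q ∧
      Q.natDegree ≤ max P.natDegree m.natDegree - 1 := by
  obtain ⟨q, hq⟩ := hs
  refine ⟨q, (P - (C s + C q * m)).divX, ?_, ?_⟩
  · have := X_mul_divX_add (P - (C s + C q * m))
    have h0 : (P - (C s + C q * m)).coeff 0 = 0 := by
      simp only [coeff_sub, coeff_add, coeff_C_zero, coeff_C_mul]
      linarith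
    rw [h0, C_0, add_zero] at this
    rw [this]; ring
  · rw [natDegree_divX_eq_natDegree_tsub_one]
    refine Nat.sub_le_sub_right ((natDegree_sub_le _ _).trans ?_) 1
    refine max_le_max le_rfl ((natDegree_add_le _ _).trans ?_)
    rw [natDegree_C]
    exact max_le (Nat.zero_le _) (natDegree_C_mul_le q m)

end Division

/-! ### The quadratic potential on conjugate vectors -/

section Potential

variable {d : ℕ} (r : Fin d → ℂ)

/-- The sum of the squared moduli of the values of `P` at the points `r i`. -/
noncomputable def sumSq (P : ℤ[X]) : ℝ := ∑ i, ‖aeval (r i) P‖ ^ 2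

/-- The real inner product of the vectors of values of `P` and `X ^ j` at the points `r i`. -/
noncomputable def innerPow (P : ℤ[X]) (j : ℕ) : ℝ := ∑ i, ((starRingEnd ℂ) (aeval (r i) P) * r i ^ j).re

theorem sumSq_nonneg (P : ℤ[X]) : 0 ≤ sumSq r P := Finset.sum_nonneg fun _ _ => by positivity

theorem norm_aeval_le_sqrt_sumSq (P : ℤ[X]) (i : Fin d) :
    ‖aeval (r i) P‖ ≤ √(sumSq r P) :=
  Real.le_sqrt_of_sq_le <|
    Finset.single_le_sum (f := fun i => ‖aeval (r i) P‖ ^ 2) (fun _ _ => by positivity)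
      (Finset.mem_univ i)

theorem aeval_eq_sum_fin {P : ℤ[X]} (hP : P.natDegree < d) (z : ℂ) :
    aeval z P = ∑ j : Fin d, (P.coeff j : ℂ) * z ^ (j : ℕ) := by
  rw [aeval_eq_sum_range' hP, Fin.sum_univ_eq_sum_range (fun j => (P.coeff j : ℂ) * z ^ j)]
  simp

variable {r}

/-- Vandermonde makes evaluation at distinct points injective, and an injective linear map in finite
dimension is bounded below. -/
theorem exists_abs_coeff_le_mul_sqrt_sumSq (hr : Function.Injective r) :
    ∃ K : ℝ, 0 < K ∧ ∀ P : ℤ[X], P.natDegree < d → ∀ j,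
      |(P.coeff j : ℝ)| ≤ K * √(sumSq r P) := by
  let L : (Fin d → ℝ) →ₗ[ℝ] (Fin d → ℂ) :=
    { toFun := fun c i => ∑ j : Fin d, (c j : ℂ) * r i ^ (j : ℕ)
      map_add' := fun c c' => by
        ext i; simp [add_mul, Finset.sum_add_distrib]
      map_smul' := fun x c => by
        ext i; simp [Finset.mul_sum, mul_assoc] }
  have hL : LinearMap.ker L = ⊥ := by
    refine LinearMap.ker_eq_bot'.2 fun c hc => ?_
    have := Matrix.eq_zero_of_forall_index_sum_mul_pow_eq_zero (v := fun j => (c j : ℂ)) hr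
      fun i => congrFun hc i
    ext j
    exact Complex.ofReal_eq_zero.1 (congrFun this j)
  obtain ⟨K, hK0, hK⟩ := L.exists_antilipschitzWith hL
  refine ⟨K, hK0, fun P hP j => ?_⟩
  rcases lt_or_ge j d with hj | hj
  · have h1 := hK.le_mul_norm (map_zero L) (fun j => (P.coeff j : ℝ))
    have h2 := norm_le_pi_norm (fun j : Fin d => (P.coeff j : ℝ)) ⟨j, hj⟩
    refine (h2.trans h1).trans (mul_le_mul_of_nonneg_left ?_ K.2)
    refine (pi_norm_le_iff_of_nonneg (Real.sqrt_nonneg _)).2 fun i => ?_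
    have : L (fun j => (P.coeff j : ℝ)) i = aeval (r i) P := by
      rw [aeval_eq_sum_fin hP]; simp [L]
    rw [this]
    exact norm_aeval_le_sqrt_sumSq r P i
  · rw [coeff_eq_zero_of_natDegree_lt (hP.trans_le hj)]
    simpa using mul_nonneg K.2 (Real.sqrt_nonneg _)

theorem sumSq_eq_sum_coeff_mul_innerPow {P : ℤ[X]} (hP : P.natDegree < d) :
    sumSq r P = ∑ j : Fin d, (P.coeff j : ℝ) * innerPow r P j := by
  have h : ∀ i, ‖aeval (r i) P‖ ^ 2 =
      ∑ j : Fin d, (P.coeff j : ℝ) * ((starRingEnd ℂ) (aeval (r i) P) * r i ^ (j : ℕ)).re := by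
    intro i
    have h1 : ((‖aeval (r i) P‖ ^ 2 : ℝ) : ℂ) =
        ∑ j : Fin d, ((P.coeff j : ℝ) : ℂ) * ((starRingEnd ℂ) (aeval (r i) P) * r i ^ (j : ℕ)) := by
      push_cast
      rw [← Complex.conj_mul']
      nth_rw 2 [aeval_eq_sum_fin hP]
      rw [Finset.mul_sum]
      exact Finset.sum_congr rfl fun j _ => by ring
    have h2 := congrArg Complex.re h1
    rw [Complex.ofReal_re, Complex.re_sum] at h2
    simpa only [Complex.re_ofReal_mul] using h2
  unfold sumSq innerPow
  simp_rw [h, Finset.mul_sum]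
  exact Finset.sum_comm

variable {P Q : ℤ[X]} {s : ℤ} {a : ℝ}

theorem sumSq_le_of_one_le_norm (hr : ∀ i, 1 ≤ ‖r i‖)
    (h : ∀ i, aeval (r i) P = s + r i * aeval (r i) Q) (hs : |(s : ℝ)| ≤ a)
    (hs' : |innerPow r P 0| ≤ s * innerPow r P 0) :
    sumSq r Q ≤ sumSq r P - 2 * |innerPow r P 0| + d * a ^ 2 := by
  have h1 : ∀ i, ‖aeval (r i) Q‖ ^ 2 ≤ ‖aeval (r i) P‖ ^ 2
      - 2 * (s * ((starRingEnd ℂ) (aeval (r i) P) * r i ^ 0).re) + a ^ 2 := by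
    intro i
    have e1 : ‖aeval (r i) Q‖ ≤ ‖aeval (r i) P - s‖ := by
      rw [h i, add_sub_cancel_left, norm_mul]
      exact le_mul_of_one_le_left (norm_nonneg _) (hr i)
    have e2 : ‖aeval (r i) P - s‖ ^ 2 = ‖aeval (r i) P‖ ^ 2
        - 2 * (s * ((starRingEnd ℂ) (aeval (r i) P) * r i ^ 0).re) + (s : ℝ) ^ 2 := by
      rw [Complex.sq_norm, Complex.sq_norm, Complex.normSq_apply, Complex.normSq_apply]
      simp
      ring
    have e3 : (s : ℝ) ^ 2 ≤ a ^ 2 := sq_le_sq' (neg_le_of_abs_le hs) (le_of_abs_le hs)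
    have e4 := pow_le_pow_left₀ (norm_nonneg _) e1 2
    linarith
  have h2 := Finset.sum_le_sum fun i (_ : i ∈ Finset.univ) => h1 i
  rw [Finset.sum_add_distrib, Finset.sum_sub_distrib, ← Finset.mul_sum, ← Finset.mul_sum] at h2
  simp only [Finset.sum_const, Finset.card_univ, Fintype.card_fin, nsmul_eq_mul] at h2
  unfold sumSq
  have : ∑ i, ((starRingEnd ℂ) (aeval (r i) P) * r i ^ 0).re = innerPow r P 0 := rfl
  rw [this] at h2
  linarith

/-- Multiplication by `r` is an isometry, so one factor `r i` cancels against its conjugate; only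
the digit contributes an error. -/
theorem abs_innerPow_succ_le (hr : ∀ i, ‖r i‖ = 1)
    (h : ∀ i, aeval (r i) P = s + r i * aeval (r i) Q) (hs : |(s : ℝ)| ≤ a) (j : ℕ) :
    |innerPow r P (j + 1)| ≤ |innerPow r Q j| + d * a := by
  have h1 : innerPow r P (j + 1) = innerPow r Q j + ∑ i, ((s : ℂ) * r i ^ (j + 1)).re := by
    unfold innerPow
    rw [← Finset.sum_add_distrib]
    refine Finset.sum_congr rfl fun i _ => ?_
    rw [← Complex.add_re, h i]
    congr 1
    have hc : (starRingEnd ℂ) (r i) * r i = 1 := by rw [Complex.conj_mul', hr i]; simp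
    simp only [map_add, map_mul, map_intCast, pow_succ]
    linear_combination (starRingEnd ℂ) (aeval (r i) Q) * r i ^ j * hc
  rw [h1]
  refine (abs_add_le _ _).trans (add_le_add le_rfl ((Finset.abs_sum_le_sum_abs _ _).trans ?_))
  calc _ ≤ ∑ _i : Fin d, a := by
        refine Finset.sum_le_sum fun i _ => (Complex.abs_re_le_norm _).trans ?_
        rw [norm_mul, norm_pow, hr i, one_pow, mul_one, Complex.norm_intCast]
        exact hs
    _ = d * a := by simp

theorem sumSq_le_of_le_norm {ρ : ℝ} (hρ : 0 ≤ ρ) (hr : ∀ i, ρ ≤ ‖r i‖)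
    (h : ∀ i, aeval (r i) P = s + r i * aeval (r i) Q) (hs : |(s : ℝ)| ≤ a) :
    ρ ^ 2 * sumSq r Q ≤ sumSq r P + 2 * d * a * √(sumSq r P) + d * a ^ 2 := by
  have ha : 0 ≤ a := (abs_nonneg _).trans hs
  have h1 : ∀ i, ρ ^ 2 * ‖aeval (r i) Q‖ ^ 2 ≤
      ‖aeval (r i) P‖ ^ 2 + (2 * a * √(sumSq r P) + a ^ 2) := by
    intro i
    have e1 : ρ * ‖aeval (r i) Q‖ ≤ ‖aeval (r i) P‖ + a := by
      calc _ ≤ ‖r i‖ * ‖aeval (r i) Q‖ := mul_le_mul_of_nonneg_right (hr i) (norm_nonneg _)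
        _ = ‖aeval (r i) P - s‖ := by rw [h i, add_sub_cancel_left, norm_mul]
        _ ≤ ‖aeval (r i) P‖ + ‖(s : ℂ)‖ := norm_sub_le _ _
        _ ≤ _ := by rw [Complex.norm_intCast]; linarith
    have e2 := pow_le_pow_left₀ (by positivity) e1 2
    have e3 := mul_le_mul_of_nonneg_left (norm_aeval_le_sqrt_sumSq r P i) ha
    nlinarith
  have h2 := Finset.sum_le_sum fun i (_ : i ∈ Finset.univ) => h1 i
  rw [Finset.sum_add_distrib, ← Finset.mul_sum] at h2
  simp only [Finset.sum_const, Finset.card_univ, Fintype.card_fin, nsmul_eq_mul] at h2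
  unfold sumSq at h2 ⊢
  linarith

end Potential

/-! ### Decrease of the potential under division -/

section Dynamics

variable {d : ℕ} {r : Fin d → ℂ} {σ : ℤ[X] → ℤ} {T : ℤ[X] → ℤ[X]} {a : ℝ}

theorem exists_sumSq_le_sub_one_of_one_lt_norm {ρ : ℝ} (hρ : 1 < ρ) (hr : ∀ i, ρ ≤ ‖r i‖)
    (hT : ∀ P i, aeval (r i) P = σ P + r i * aeval (r i) (T P)) (hσ : ∀ P, |(σ P : ℝ)| ≤ a) :
    ∃ R : ℝ, ∀ P, R < sumSq r P → sumSq r (T P) ≤ sumSq r P - 1 := by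
  have ha : 0 ≤ a := (abs_nonneg _).trans (hσ 0)
  have hρ2 : 0 < ρ ^ 2 - 1 := by nlinarith
  -- Beyond `M`, the gain `(ρ ^ 2 - 1) * t ^ 2` absorbs the linear and constant errors and the unit
  -- drop.
  set M : ℝ := 1 + (2 * d * a + d * a ^ 2 + ρ ^ 2) / (ρ ^ 2 - 1) with hM
  have hM1 : 1 ≤ M := by
    have : 0 ≤ (2 * d * a + d * a ^ 2 + ρ ^ 2) / (ρ ^ 2 - 1) := by positivity
    linarith
  refine ⟨M ^ 2, fun P hP => ?_⟩
  have h1 := sumSq_le_of_le_norm (by linarith) hr (hT P) (hσ P)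
  set t := √(sumSq r P) with ht
  have ht2 : sumSq r P = t ^ 2 := (Real.sq_sqrt (sumSq_nonneg r P)).symm
  have hMt : M ≤ t := Real.le_sqrt_of_sq_le hP.le
  have h2 : 2 * d * a + d * a ^ 2 + ρ ^ 2 ≤ (ρ ^ 2 - 1) * t := by
    rw [← div_le_iff₀' hρ2]; linarith
  have ht1 : 1 ≤ t := hM1.trans hMt
  have h3 : (2 * d * a + d * a ^ 2 + ρ ^ 2) * t ≤ (ρ ^ 2 - 1) * t * t :=
    mul_le_mul_of_nonneg_right h2 (by linarith)
  have h4 : d * a ^ 2 + ρ ^ 2 ≤ (d * a ^ 2 + ρ ^ 2) * t :=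
    le_mul_of_one_le_right (by positivity) ht1
  rw [ht2] at h1 ⊢
  have h5 : ρ ^ 2 * sumSq r (T P) ≤ ρ ^ 2 * (t ^ 2 - 1) := by nlinarith
  exact le_of_mul_le_mul_left h5 (by positivity)

theorem exists_sumSq_iterate_le_sub_one_of_norm_eq_one (hinj : Function.Injective r)
    (hr : ∀ i, ‖r i‖ = 1)
    (hT : ∀ P i, aeval (r i) P = σ P + r i * aeval (r i) (T P)) (hσ : ∀ P, |(σ P : ℝ)| ≤ a)
    (hσ' : ∀ P, |innerPow r P 0| ≤ σ P * innerPow r P 0) :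
    ∃ R : ℝ, ∀ P : ℤ[X], P.natDegree < d → R < sumSq r P →
      sumSq r (T^[d] P) ≤ sumSq r P - 1 := by
  have ha : 0 ≤ a := (abs_nonneg _).trans (hσ 0)
  have drop : ∀ n P, sumSq r (T^[n] P) ≤
      sumSq r P - 2 * ∑ j ∈ Finset.range n, |innerPow r (T^[j] P) 0| + n * (d * a ^ 2) := by
    intro n P
    induction n with
    | zero => simp
    | succ n ih =>
      have := sumSq_le_of_one_le_norm (fun i => (hr i).ge) (hT (T^[n] P)) (hσ _) (hσ' _)
      rw [Function.iterate_succ_apply', Finset.sum_range_succ]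
      push_cast
      linarith
  have shift : ∀ j P, |innerPow r P j| ≤ |innerPow r (T^[j] P) 0| + j * (d * a) := by
    intro j
    induction j with
    | zero => simp
    | succ j ih =>
      intro P
      have h1 := abs_innerPow_succ_le hr (hT P) (hσ P) j
      have h2 := ih (T P)
      rw [Function.iterate_succ_apply]
      push_cast
      linarith
  obtain ⟨K, hK0, hK⟩ := exists_abs_coeff_le_mul_sqrt_sumSq hinj
  -- `A` bounds the total error of replacing `r ^ j` by `j` division steps; `M` makes the inner
  -- products outweigh it and the `d` digit terms.
  set A : ℝ := d * (d * (d * a)) with hA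
  set M : ℝ := K * (2 * A + d * (d * a ^ 2) + 1) with hM
  refine ⟨M ^ 2, fun P hP hMP => ?_⟩
  have hM0 : 0 ≤ M := by positivity
  set t := √(sumSq r P) with ht
  have ht2 : sumSq r P = t ^ 2 := (Real.sq_sqrt (sumSq_nonneg r P)).symm
  have hMt : M ≤ t := Real.le_sqrt_of_sq_le hMP.le
  have ht0 : 0 < t := Real.sqrt_pos.2 ((sq_nonneg M).trans_lt hMP)
  have h1 : ∑ j ∈ Finset.range d, |innerPow r P j| ≤
      ∑ j ∈ Finset.range d, |innerPow r (T^[j] P) 0| + A := by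
    have : A = ∑ _j ∈ Finset.range d, (d : ℝ) * (d * a) := by simp [hA]
    rw [this, ← Finset.sum_add_distrib]
    refine Finset.sum_le_sum fun j hj => (shift j P).trans ?_
    have : (j : ℝ) ≤ d := by exact_mod_cast (Finset.mem_range.1 hj).le
    gcongr
  have h2 : t ≤ K * ∑ j ∈ Finset.range d, |innerPow r P j| := by
    refine le_of_mul_le_mul_left (a := t) ?_ ht0
    calc t * t = sumSq r P := by rw [ht2]; ring
      _ = ∑ j : Fin d, (P.coeff j : ℝ) * innerPow r P j := sumSq_eq_sum_coeff_mul_innerPow hP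
      _ ≤ ∑ j : Fin d, K * t * |innerPow r P j| := by
        refine Finset.sum_le_sum fun j _ => (le_abs_self _).trans ?_
        rw [abs_mul]
        exact mul_le_mul_of_nonneg_right (hK P hP j) (abs_nonneg _)
      _ = _ := by
        rw [← Finset.mul_sum, Fin.sum_univ_eq_sum_range (fun j => |innerPow r P j|)]; ring
  have h3 : 2 * A + d * (d * a ^ 2) + 1 ≤ ∑ j ∈ Finset.range d, |innerPow r P j| :=
    le_of_mul_le_mul_left (hMt.trans h2) hK0
  have h4 := drop d P
  have hA0 : 0 ≤ A := by positivity
  have : 0 ≤ (d : ℝ) * (d * a ^ 2) := by positivity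
  linarith

end Dynamics

/-! ### Assembling the division step -/

section Sufficiency

theorem exists_int_multiple_minpoly {α : ℂ} (hα : IsAlgebraic ℚ α) (h0 : α ≠ 0) :
    ∃ m : ℤ[X], m.natDegree ≤ (minpoly ℚ α).natDegree ∧ m.coeff 0 ≠ 0 ∧
      ∀ β, IsConjRoot ℚ α β → aeval β m = 0 := by
  obtain ⟨b, hb, hm⟩ := IsLocalization.integerNormalization_spec (nonZeroDivisors ℤ) (minpoly ℚ α)
  set m := IsLocalization.integerNormalization (nonZeroDivisors ℤ) (minpoly ℚ α)
  refine ⟨m, ?_, ?_, fun β hβ => ?_⟩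
  · rw [← natDegree_map_eq_of_injective (algebraMap ℤ ℚ).injective_int m, hm]
    exact natDegree_smul_le _ _
  · intro h
    have h1 : (m.map (algebraMap ℤ ℚ)).coeff 0 = 0 := by rw [coeff_map, h, map_zero]
    rw [hm, coeff_smul, smul_eq_zero] at h1
    rcases h1 with h1 | h1
    · exact nonZeroDivisors.ne_zero hb h1
    · exact minpoly.coeff_zero_ne_zero hα.isIntegral h0 h1
  · exact IsLocalization.integerNormalization_aeval_eq_zero _ _ hβ.aeval_eq_zero

theorem exists_fin_conjugates {α : ℂ} (hα : IsAlgebraic ℚ α) :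
    ∃ r : Fin (minpoly ℚ α).natDegree → ℂ, Function.Injective r ∧
      (∀ i, IsConjRoot ℚ α (r i)) ∧ ∃ i, r i = α := by
  have hint := hα.isIntegral
  have hcard : Fintype.card ((minpoly ℚ α).rootSet ℂ) = (minpoly ℚ α).natDegree :=
    card_rootSet_eq_natDegree (minpoly.irreducible hint).separable (IsAlgClosed.splits _)
  let e := (Fintype.equivFinOfCardEq hcard).symm
  have hmem : ∀ β, IsConjRoot ℚ α β ↔ β ∈ (minpoly ℚ α).rootSet ℂ := fun β =>
    (isConjRoot_iff_aeval_eq_zero hint).trans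
      (by rw [mem_rootSet]; exact ⟨fun h => ⟨minpoly.ne_zero hint, h⟩, fun h => h.2⟩)
  refine ⟨fun i => e i, Subtype.val_injective.comp e.injective, fun i => (hmem _).2 (e i).2,
    e.symm ⟨α, (hmem α).1 IsConjRoot.refl⟩, by simp⟩

theorem heightReducing_of_norm {α : ℂ} (hα : IsAlgebraic ℚ α)
    (h : (∀ β : ℂ, IsConjRoot ℚ α β → ‖β‖ = 1) ∨ (∀ β : ℂ, IsConjRoot ℚ α β → 1 < ‖β‖)) :
    HeightReducing α := by
  have h0 : α ≠ 0 := by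
    rintro rfl
    rcases h with h | h <;> have := h 0 IsConjRoot.refl <;> norm_num at this
  obtain ⟨m, hmd, hm0, hm⟩ := exists_int_multiple_minpoly hα h0
  obtain ⟨r, hinj, hconj, i₀, hi₀⟩ := exists_fin_conjugates hα
  have hd : 0 < (minpoly ℚ α).natDegree := minpoly.natDegree_pos hα.isIntegral
  generalize (minpoly ℚ α).natDegree = d at *
  choose σ hσdvd hσ hσ' using fun P : ℤ[X] => exists_digit hm0 (P.coeff 0) (innerPow r P 0)
  choose q T hPT hTdeg using fun P : ℤ[X] => exists_eq_C_add_C_mul_add_X_mul m P (hσdvd P)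
  have hT : ∀ P i, aeval (r i) P = σ P + r i * aeval (r i) (T P) := by
    intro P i
    conv_lhs => rw [hPT P]
    simp [hm _ (hconj i)]
  have hσR : ∀ P, |(σ P : ℝ)| ≤ (|m.coeff 0| : ℤ) := fun P => by exact_mod_cast hσ P
  obtain ⟨K, hK0, hK⟩ := exists_abs_coeff_le_mul_sqrt_sumSq hinj
  have key : ∃ R : ℝ, ∀ P : ℤ[X], P.natDegree < d → R < sumSq r P →
      ∃ k, sumSq r (T^[k] P) ≤ sumSq r P - 1 := by
    rcases h with h | h
    · obtain ⟨R, hR⟩ := exists_sumSq_iterate_le_sub_one_of_norm_eq_one hinj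
        (fun i => h _ (hconj i)) hT hσR hσ'
      exact ⟨R, fun P hP hPR => ⟨d, hR P hP hPR⟩⟩
    · obtain ⟨i₁, -, hi₁⟩ := Finset.exists_min_image Finset.univ (fun i => ‖r i‖)
        ⟨i₀, Finset.mem_univ _⟩
      obtain ⟨R, hR⟩ := exists_sumSq_le_sub_one_of_one_lt_norm (h _ (hconj i₁))
        (fun i => hi₁ i (Finset.mem_univ i)) hT hσR
      exact ⟨R, fun P _ hPR => ⟨1, hR P hPR⟩⟩
  obtain ⟨R, hR⟩ := key
  refine heightReducing_of_potential (d := d) |m.coeff 0| σ T hσ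
    (fun P => by simpa only [hi₀] using hT P i₀) (fun P n hn hP => ?_) (sumSq r) R (K * √R)
    (fun P hP hPR j => (hK P (by omega) j).trans ?_) (fun P hP => hR P (by omega))
  · exact (hTdeg P).trans (Nat.sub_le_sub_right (max_le hP (hmd.trans hn)) 1)
  · gcongr

end Sufficiency

theorem mainTheorem1 (α : ℂ) :
    HeightReducing α ↔
      IsAlgebraic ℚ α ∧
        ((∀ β : ℂ, IsConjRoot ℚ α β → ‖β‖ = 1) ∨ (∀ β : ℂ, IsConjRoot ℚ α β → 1 < ‖β‖)) :=
  ⟨fun h => ⟨h.isAlgebraic, h.norm_dichotomy⟩, fun h => heightReducing_of_norm h.1 h.2⟩
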